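/- Let $\mathcal G$ be a set, let $\mathbb F_{\mathcal G}$ be the free group on $\mathcal G$, and let $\alpha$ be a partial action of $\mathbb F_{\mathcal G}$ on a (not necessarily unital) $C^*$-algebra $\mathcal A$: that is, closed two-sided ideals $D_t$ of $\mathcal A$ and $*$-isomorphisms $\alpha_t : D_{t^{-1}} \to D_t$ ($t \in \mathbb F_{\mathcal G}$) such that $D_e = \mathcal A$, $\alpha_e = \mathrm{id}$, and $\alpha_{st}$ extends $\alpha_s \circ \alpha_t$ for all $s,t$. For a subgroup $H$, let $\mathcal A \rtimes_\alpha H$ denote the full crossed product by the restricted partial action, i.e. the enveloping $C^*$-algebra of the $*$-algebra of finite sums $\sum_{t \in H} a_t \delta_t$, $a_t \in D_t$, with $(a\delta_s)(b\delta_t) = \alpha_s(\alpha_s^{-1}(a)b)\,\delta_{st}$ and $(a\delta_t)^* = \alpha_t^{-1}(a^*)\,\delta_{t^{-1}}$. Let $\Lambda$ be the collection of finite subsets of $\mathcal G$, directed by inclusion, and for $\lambda \in \Lambda$ let $\mathbb F_\lambda \subseteq \mathbb F_{\mathcal G}$ be the subgroup generated by $\lambda$. Then: 1. For all $\lambda \subseteq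 \mu$ in $\Lambda$ there is a unique $*$-homomorphism $\Phi_\lambda^\mu : \mathcal A \rtimes_\alpha \mathbb F_\lambda \to \mathcal A \rtimes_\alpha \mathbb F_\mu$ determined by the inclusion $\mathbb F_\lambda \subseteq \mathbb F_\mu$, i.e. with $\Phi_\lambda^\mu(a\delta_t) = a\delta_t$ for $t \in \mathbb F_\lambda$, $a \in D_t$; likewise there is a unique $*$-homomorphism $\Phi_\lambda^{\mathcal G} : \mathcal A \rtimes_\alpha \mathbb F_\lambda \to \mathcal A \rtimes_\alpha \mathbb F_{\mathcal G}$ with $\Phi_\lambda^{\mathcal G}(a\delta_t) = a\delta_t$ for all such $t$ and $a$. 2. The $\Phi_\lambda^\mu$ form a directed system: $\Phi_\lambda^\lambda = \mathrm{id}$ and $\Phi_\mu^\nu \circ \Phi_\lambda^\mu = \Phi_\lambda^\nu$ for $\lambda \subseteq \mu \subseteq \nu$. 3. $\mathcal A \rtimes_\alpha \mathbb F_{\mathcal G}$, with the maps $\Phi_\lambda^{\mathcal G}$, is the inductive limit $\lim_\lambda \mathcal A \rtimes_\alpha \mathbb F_\lambda$ of this system in the category of $C^*$-algebras: $\Phi_\mu^{\mathcal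 G} \circ \Phi_\lambda^\mu = \Phi_\lambda^{\mathcal G}$ for $\lambda \subseteq \mu$, and for every $C^*$-algebra $B$ and every family of $*$-homomorphisms $\psi_\lambda : \mathcal A \rtimes_\alpha \mathbb F_\lambda \to B$ with $\psi_\mu \circ \Phi_\lambda^\mu = \psi_\lambda$ for all $\lambda \subseteq \mu$, there is a unique $*$-homomorphism $\sigma : \mathcal A \rtimes_\alpha \mathbb F_{\mathcal G} \to B$ with $\sigma \circ \Phi_\lambda^{\mathcal G} = \psi_\lambda$ for all $\lambda$. -/

import Mathlib

universe u v w

section CStarSeminorm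

/-- A C⋆-seminorm on a complex ⋆-algebra `S`: a seminorm with `p (x * y) ≤ p x * p y` and
`p (star x * x) = p x ^ 2`. -/
structure CStarSeminorm (S : Type u) [NonUnitalRing S] [StarRing S] [Module ℂ S] extends
    Seminorm ℂ S where
  mul_le' : ∀ x y, toFun (x * y) ≤ toFun x * toFun y
  star_mul_self' : ∀ x, toFun (star x * x) = toFun x * toFun x

namespace CStarSeminorm

variable {S : Type u} [NonUnitalRing S] [StarRing S] [Module ℂ S]

instance : CoeFun (CStarSeminorm S) (fun _ => S → ℝ) := ⟨fun p => p.toFun⟩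

theorem map_zero (p : CStarSeminorm S) : p 0 = 0 := p.map_zero'

theorem nonneg (p : CStarSeminorm S) (x : S) : 0 ≤ p x := apply_nonneg p.toSeminorm x

theorem map_add_le (p : CStarSeminorm S) (x y : S) : p (x + y) ≤ p x + p y := p.add_le' x y

theorem map_neg (p : CStarSeminorm S) (x : S) : p (-x) = p x := p.neg' x

theorem map_smul (p : CStarSeminorm S) (c : ℂ) (x : S) : p (c • x) = ‖c‖ * p x := p.smul' c x

theorem map_star_le (p : CStarSeminorm S) (x : S) : p x ≤ p (star x) := by
  by_cases h : p x = 0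
  · rw [h]; exact p.nonneg _
  · have h0 : 0 < p x := lt_of_le_of_ne (p.nonneg x) (Ne.symm h)
    have h1 : p x * p x ≤ p (star x) * p x := by
      rw [← p.star_mul_self' x]; exact p.mul_le' _ _
    exact le_of_mul_le_mul_right h1 h0

theorem map_star (p : CStarSeminorm S) (x : S) : p (star x) = p x :=
  le_antisymm (by simpa using p.map_star_le (star x)) (p.map_star_le x)

/-- The ⋆-algebra `S`, to be seminormed by `p`. -/
def Pre (_p : CStarSeminorm S) : Type u := S

section Pre

variable (p : CStarSeminorm S)

/-- The identity map from `S` to `S` seminormed by `p`. -/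
def toPre : S → p.Pre := id

/-- The identity map from `S` seminormed by `p` to `S`. -/
def ofPre : p.Pre → S := id

instance : NonUnitalRing p.Pre := inferInstanceAs (NonUnitalRing S)

instance : StarRing p.Pre := inferInstanceAs (StarRing S)

instance : Module ℂ p.Pre := inferInstanceAs (Module ℂ S)

instance [StarModule ℂ S] : StarModule ℂ p.Pre := inferInstanceAs (StarModule ℂ S)

instance [IsScalarTower ℂ S S] : IsScalarTower ℂ p.Pre p.Pre :=
  inferInstanceAs (IsScalarTower ℂ S S)

instance [SMulCommClass ℂ S S] : SMulCommClass ℂ p.Pre p.Pre :=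
  inferInstanceAs (SMulCommClass ℂ S S)

noncomputable instance : SeminormedAddCommGroup p.Pre :=
  AddGroupSeminorm.toSeminormedAddCommGroup
    (⟨p.toFun, p.map_zero', p.add_le', p.neg'⟩ : AddGroupSeminorm p.Pre)

theorem norm_pre (x : p.Pre) : ‖x‖ = p (p.ofPre x) := rfl

noncomputable instance : NonUnitalSeminormedRing p.Pre where
  dist_eq := SeminormedAddCommGroup.dist_eq
  norm_mul_le x y := p.mul_le' x y

noncomputable instance : NormedSpace ℂ p.Pre where
  norm_smul_le c x := le_of_eq (p.map_smul c x)

end Pre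

/-- The Hausdorff completion of `S` with respect to `p`. -/
def Completion (p : CStarSeminorm S) : Type u := UniformSpace.Completion p.Pre

section Completion

open UniformSpace UniformSpace.Completion Function

variable (p : CStarSeminorm S)

noncomputable instance : NormedAddCommGroup p.Completion :=
  inferInstanceAs (NormedAddCommGroup (UniformSpace.Completion p.Pre))

noncomputable instance : NormedSpace ℂ p.Completion :=
  inferInstanceAs (NormedSpace ℂ (UniformSpace.Completion p.Pre))

instance : CompleteSpace p.Completion :=
  inferInstanceAs (CompleteSpace (UniformSpace.Completion p.Pre))

/-- The canonical map from `S` to its completion. -/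
noncomputable def emb (x : S) : p.Completion := ((p.toPre x : p.Pre) : UniformSpace.Completion p.Pre)

theorem norm_emb (x : S) : ‖p.emb x‖ = p x :=
  UniformSpace.Completion.norm_coe (p.toPre x)

theorem emb_add (x y : S) : p.emb (x + y) = p.emb x + p.emb y :=
  UniformSpace.Completion.coe_add (p.toPre x) (p.toPre y)

theorem emb_zero : p.emb 0 = 0 := UniformSpace.Completion.coe_zero

theorem emb_smul (c : ℂ) (x : S) : p.emb (c • x) = c • p.emb x :=
  UniformSpace.Completion.coe_smul c (p.toPre x)

/-- The product of the completion: the continuous extension of the product of `S`. -/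
noncomputable instance : Mul p.Completion :=
  ⟨curry <| ((isDenseInducing_coe (α := p.Pre)).prodMap
    (isDenseInducing_coe (α := p.Pre))).extend
      (fun q : p.Pre × p.Pre => ((q.1 * q.2 : p.Pre) : UniformSpace.Completion p.Pre))⟩

theorem emb_mul (x y : S) : p.emb (x * y) = p.emb x * p.emb y :=
  (((isDenseInducing_coe (α := p.Pre)).prodMap isDenseInducing_coe).extend_eq
      ((continuous_coe p.Pre).comp (@continuous_mul p.Pre _ _ _)) (p.toPre x, p.toPre y)).symm

instance : ContinuousMul p.Completion where
  continuous_mul := by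
    let m := (AddMonoidHom.mul : p.Pre →+ p.Pre →+ p.Pre).compr₂ toCompl
    have hm : Continuous fun q : p.Pre × p.Pre => m q.1 q.2 :=
      (continuous_coe p.Pre).comp continuous_mul
    have di : IsDenseInducing (toCompl : p.Pre → UniformSpace.Completion p.Pre) :=
      isDenseInducing_coe
    exact (di.extend_Z_bilin di hm)

theorem continuous_star_pre : UniformContinuous (fun x : p.Pre => star x) := by
  refine (LipschitzWith.of_dist_le_mul (K := 1) fun x y => ?_).uniformContinuous
  rw [dist_eq_norm, dist_eq_norm, ← star_sub, NNReal.coe_one, one_mul]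
  exact le_of_eq (p.map_star _)

/-- The involution of the completion: the continuous extension of the involution of `S`. -/
noncomputable instance : Star p.Completion :=
  ⟨UniformSpace.Completion.map (fun x : p.Pre => star x)⟩

theorem emb_star (x : S) : p.emb (star x) = star (p.emb x) :=
  (UniformSpace.Completion.map_coe p.continuous_star_pre (p.toPre x)).symm

instance : ContinuousStar p.Completion where
  continuous_star := UniformSpace.Completion.continuous_map

theorem denseRange_emb : DenseRange p.emb :=
  UniformSpace.Completion.denseRange_coe (α := p.Pre)

variable {p} in
theorem ind {P : p.Completion → Prop} (hP : IsClosed {x | P x}) (h : ∀ x : S, P (p.emb x))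
    (x : p.Completion) : P x :=
  UniformSpace.Completion.induction_on (α := p.Pre) x hP h

variable {p} in
theorem ind₂ {P : p.Completion → p.Completion → Prop} (hP : IsClosed {x : _ × _ | P x.1 x.2})
    (h : ∀ x y : S, P (p.emb x) (p.emb y)) (x y : p.Completion) : P x y :=
  UniformSpace.Completion.induction_on₂ (α := p.Pre) (β := p.Pre) x y hP h

variable {p} in
theorem ind₃ {P : p.Completion → p.Completion → p.Completion → Prop}
    (hP : IsClosed {x : _ × _ × _ | P x.1 x.2.1 x.2.2})
    (h : ∀ x y z : S, P (p.emb x) (p.emb y) (p.emb z)) (x y z : p.Completion) : P x y z :=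
  UniformSpace.Completion.induction_on₃ (α := p.Pre) (β := p.Pre) (γ := p.Pre) x y z hP h

theorem continuous_smul_completion (c : ℂ) : Continuous fun x : p.Completion => c • x :=
  (lipschitzWith_smul c).continuous

theorem smul_mul_completion [IsScalarTower ℂ S S] (c : ℂ) (x y : p.Completion) :
    (c • x) * y = c • (x * y) :=
  ind₂ (P := fun x y => (c • x) * y = c • (x * y)) (isClosed_eq
      (((p.continuous_smul_completion c).comp continuous_fst).mul continuous_snd)
      ((p.continuous_smul_completion c).comp (continuous_fst.mul continuous_snd)))
    (fun x y => by simp only [← emb_smul, ← emb_mul, smul_mul_assoc]) x y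

theorem mul_smul_completion [SMulCommClass ℂ S S] (c : ℂ) (x y : p.Completion) :
    c • (x * y) = x * (c • y) :=
  ind₂ (P := fun x y => c • (x * y) = x * (c • y)) (isClosed_eq
      ((p.continuous_smul_completion c).comp (continuous_fst.mul continuous_snd))
      (continuous_fst.mul ((p.continuous_smul_completion c).comp continuous_snd)))
    (fun x y => by simp only [← emb_smul, ← emb_mul, mul_smul_comm]) x y

theorem star_smul_completion [StarModule ℂ S] (c : ℂ) (x : p.Completion) :
    star (c • x) = star c • star x :=
  ind (P := fun x => star (c • x) = star c • star x) (isClosed_eq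
      (p.continuous_smul_completion c).star
      ((p.continuous_smul_completion (star c)).comp continuous_star))
    (fun x => by simp only [← emb_smul, ← emb_star, star_smul]) x

noncomputable instance : NonUnitalRing p.Completion where
  zero_mul := ind (isClosed_eq (by fun_prop) (by fun_prop)) fun x => by
    rw [← emb_zero, ← emb_mul, zero_mul]
  mul_zero := ind (isClosed_eq (by fun_prop) (by fun_prop)) fun x => by
    rw [← emb_zero, ← emb_mul, mul_zero]
  mul_assoc := ind₃ (isClosed_eq (by fun_prop) (by fun_prop)) fun x y z => by
    simp only [← emb_mul, mul_assoc]
  left_distrib := ind₃ (isClosed_eq (by fun_prop) (by fun_prop)) fun x y z => by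
    simp only [← emb_mul, ← emb_add, mul_add]
  right_distrib := ind₃ (isClosed_eq (by fun_prop) (by fun_prop)) fun x y z => by
    simp only [← emb_mul, ← emb_add, add_mul]

noncomputable instance : StarRing p.Completion where
  star_involutive := ind (isClosed_eq (by fun_prop) (by fun_prop)) fun x => by
    rw [← emb_star, ← emb_star, star_star]
  star_mul := ind₂ (isClosed_eq (by fun_prop) (by fun_prop)) fun x y => by
    simp only [← emb_star, ← emb_mul, star_mul]
  star_add := ind₂ (isClosed_eq (by fun_prop) (by fun_prop)) fun x y => by
    simp only [← emb_star, ← emb_add, star_add]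

noncomputable instance : NonUnitalNormedRing p.Completion where
  dist_eq := NormedAddCommGroup.dist_eq
  norm_mul_le := ind₂ (isClosed_le (by fun_prop) (by fun_prop)) fun x y => by
    rw [← emb_mul, norm_emb, norm_emb, norm_emb]; exact p.mul_le' x y

variable [IsScalarTower ℂ S S] [SMulCommClass ℂ S S] [StarModule ℂ S]

/-- The Hausdorff completion of a ⋆-algebra with respect to a C⋆-seminorm is a C⋆-algebra. -/
noncomputable instance : NonUnitalCStarAlgebra p.Completion where
  norm_mul_self_le := ind (isClosed_le (by fun_prop) (by fun_prop)) fun x => by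
    rw [← emb_star, ← emb_mul, norm_emb, norm_emb]; exact (p.star_mul_self' x).ge
  smul_assoc c x y := p.smul_mul_completion c x y
  smul_comm c x y := p.mul_smul_completion c x y
  star_smul c x := p.star_smul_completion c x

/-- The canonical ⋆-homomorphism from `S` to its completion. -/
noncomputable def embHom : S →⋆ₙₐ[ℂ] p.Completion where
  toFun := p.emb
  map_smul' := p.emb_smul
  map_zero' := p.emb_zero
  map_add' := p.emb_add
  map_mul' := p.emb_mul
  map_star' := p.emb_star

end Completion

/-- The pullback of a C⋆-seminorm along a ⋆-homomorphism. -/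
def comp {T : Type v} [NonUnitalRing T] [StarRing T] [Module ℂ T] (p : CStarSeminorm S)
    (f : T →⋆ₙₐ[ℂ] S) : CStarSeminorm T where
  toFun x := p (f x)
  map_zero' := by rw [_root_.map_zero]; exact p.map_zero
  add_le' x y := by rw [map_add]; exact p.map_add_le _ _
  neg' x := by
    have h : f (-x) = -f x := by
      have := _root_.map_smul f (-1 : ℂ) x
      simpa only [neg_smul, one_smul] using this
    rw [h]; exact p.map_neg _
  smul' c x := by rw [_root_.map_smul]; exact p.map_smul _ _
  mul_le' x y := by rw [map_mul]; exact p.mul_le' _ _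
  star_mul_self' x := by rw [map_mul, StarHomClass.map_star f]; exact p.star_mul_self' _

/-- A C⋆-seminorm on a C⋆-algebra is dominated by the norm. -/
theorem le_norm {A : Type v} [NonUnitalCStarAlgebra A] (p : CStarSeminorm A) (a : A) :
    p a ≤ ‖a‖ := by
  rw [← p.norm_emb a]
  exact NonUnitalStarAlgHom.norm_apply_le p.embHom a

instance : Inhabited (CStarSeminorm S) :=
  ⟨{  toFun := fun _ => 0
      map_zero' := rfl
      add_le' := fun _ _ => by simp
      neg' := fun _ => rfl
      smul' := fun _ _ => by simp
      mul_le' := fun _ _ => by simp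
      star_mul_self' := fun _ => by simp }⟩

/-- The largest C⋆-seminorm on a ⋆-algebra on which the C⋆-seminorms are pointwise bounded. -/
noncomputable def largest (hb : ∀ x : S, BddAbove (Set.range fun p : CStarSeminorm S => p x)) :
    CStarSeminorm S where
  toFun x := ⨆ p : CStarSeminorm S, p x
  map_zero' := by simp only [map_zero, ciSup_const]
  add_le' x y := ciSup_le fun p =>
    (p.map_add_le x y).trans (add_le_add (le_ciSup (hb x) p) (le_ciSup (hb y) p))
  neg' x := by simp only [map_neg]
  smul' c x := by simp only [map_smul, Real.mul_iSup_of_nonneg (norm_nonneg c)]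
  mul_le' x y := ciSup_le fun p =>
    (p.mul_le' x y).trans (mul_le_mul (le_ciSup (hb x) p) (le_ciSup (hb y) p) (p.nonneg y)
      ((p.nonneg x).trans (le_ciSup (hb x) p)))
  star_mul_self' x := by
    have h0 : 0 ≤ ⨆ p : CStarSeminorm S, p x :=
      (nonneg default x).trans (le_ciSup (hb x) default)
    refine le_antisymm (ciSup_le fun p => ?_) ?_
    · rw [p.star_mul_self']
      exact mul_le_mul (le_ciSup (hb x) p) (le_ciSup (hb x) p) (p.nonneg x) h0
    · have h1 : ∀ p : CStarSeminorm S, p x ≤ √(⨆ p : CStarSeminorm S, p (star x * x)) := fun p => by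
        refine Real.le_sqrt_of_sq_le ?_
        rw [sq, ← p.star_mul_self']
        exact le_ciSup (hb (star x * x)) p
      have h2 := ciSup_le h1
      have h3 : 0 ≤ ⨆ p : CStarSeminorm S, p (star x * x) :=
        (nonneg default _).trans (le_ciSup (hb (star x * x)) default)
      calc _ ≤ √(⨆ p : CStarSeminorm S, p (star x * x)) * √(⨆ p : CStarSeminorm S, p (star x * x)) :=
            mul_le_mul h2 h2 h0 (Real.sqrt_nonneg _)
        _ = _ := Real.mul_self_sqrt h3

end CStarSeminorm

end CStarSeminorm

/-- A partial action of a (discrete) group `G` on a C⋆-algebra `A`: closed two-sided ideals `D t`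
and ⋆-isomorphisms `map t : D t⁻¹ → D t` such that `D 1 = A`, `map 1` is the identity and
`map (s * t)` extends the composition `map s ∘ map t`, taken on its largest domain. (Closed
two-sided ideals of a C⋆-algebra are complex subspaces and invariant under the involution, so
they are exactly the closed ⋆-subalgebras that absorb products.) -/
structure PartialAction (G : Type u) [Group G] (A : Type v) [NonUnitalCStarAlgebra A] where
  D : G → NonUnitalStarSubalgebra ℂ A
  isClosed : ∀ t, IsClosed (D t : Set A)
  mul_mem_left : ∀ t (a : A) {x : A}, x ∈ D t → a * x ∈ D t
  mul_mem_right : ∀ t {x : A} (a : A), x ∈ D t → x * a ∈ D t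
  map : ∀ t, D t⁻¹ ≃⋆ₐ[ℂ] D t
  D_one : D 1 = ⊤
  map_one : ∀ x : D 1⁻¹, (map 1 x : A) = x
  map_mul : ∀ s t (x : A) (hx : x ∈ D t⁻¹) (hy : (map t ⟨x, hx⟩ : A) ∈ D s⁻¹),
    ∃ hst : x ∈ D (s * t)⁻¹, (map (s * t) ⟨x, hst⟩ : A) = map s ⟨map t ⟨x, hx⟩, hy⟩

namespace PartialAction

variable {G : Type u} [Group G] {A : Type v} [NonUnitalCStarAlgebra A] (α : PartialAction G A)

section Shortcuts

variable (t : G)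

instance : Add (α.D t) := inferInstance

instance : Mul (α.D t) := inferInstance

instance : SMul ℂ (α.D t) := inferInstance

instance : Star (α.D t) := inferInstance

end Shortcuts

/-- The restriction of a partial action to a subgroup. -/
abbrev restrict (H : Subgroup G) : PartialAction H A where
  D t := α.D t
  isClosed t := α.isClosed t
  mul_mem_left t := α.mul_mem_left t
  mul_mem_right t := α.mul_mem_right t
  map t := α.map t
  D_one := α.D_one
  map_one := α.map_one
  map_mul s t := α.map_mul s t

theorem coe_star (t : G) (x : α.D t) : ((star x : α.D t) : A) = star (x : A) := rfl

theorem map_congr {s t : G} (h : s = t) {x y : A} (hxy : x = y) (hx : x ∈ α.D s⁻¹)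
    (hy : y ∈ α.D t⁻¹) : (α.map s ⟨x, hx⟩ : A) = α.map t ⟨y, hy⟩ := by
  subst h; subst hxy; rfl

theorem map_inv (t : G) (x : α.D t) (hx : (x : A) ∈ α.D t⁻¹⁻¹) :
    (α.map t⁻¹ ⟨x, hx⟩ : A) = (α.map t).symm x := by
  have h1 : (α.map t ⟨(α.map t).symm x, ((α.map t).symm x).2⟩ : A) = x := by
    rw [Subtype.coe_eta, StarAlgEquiv.apply_symm_apply]
  obtain ⟨h2, h3⟩ := α.map_mul t⁻¹ t ((α.map t).symm x) ((α.map t).symm x).2 (by rw [h1]; exact hx)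
  have h4 : (1 : G)⁻¹ = (t⁻¹ * t)⁻¹ := by simp
  have h5 : (((α.map t).symm x : α.D t⁻¹) : A) ∈ α.D 1⁻¹ := by rw [h4]; exact h2
  rw [α.map_congr rfl h1.symm hx (by rw [h1]; exact hx), ← h3,
    α.map_congr (inv_mul_cancel t) rfl h2 h5, α.map_one]

theorem map_inv_symm (t : G) (x : α.D t⁻¹) : ((α.map t⁻¹).symm x : A) = α.map t x := by
  have h0 : (α.map t x : A) ∈ α.D t⁻¹⁻¹ := by rw [inv_inv]; exact (α.map t x).2
  have h1 := α.map_inv t (α.map t x) h0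
  rw [StarAlgEquiv.symm_apply_apply] at h1
  have h2 : x = α.map t⁻¹ ⟨α.map t x, h0⟩ := Subtype.ext h1.symm
  conv_lhs => rw [h2]
  rw [StarAlgEquiv.symm_apply_apply]

theorem map_mul_symm (h : G) (a : A) (b : α.D h) (c : A) :
    (α.map h ⟨((α.map h).symm ⟨a * b, α.mul_mem_left h a b.2⟩ : A) * c,
        α.mul_mem_right _ c ((α.map h).symm _).2⟩ : A)
      = a * α.map h ⟨((α.map h).symm b : A) * c, α.mul_mem_right _ c ((α.map h).symm b).2⟩ := by
  have key : ∀ (d e : α.D h) (x : A),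
      (d : A) * α.map h ⟨((α.map h).symm e : A) * x, α.mul_mem_right _ x ((α.map h).symm e).2⟩
        = α.map h ⟨((α.map h).symm (d * e) : A) * x,
            α.mul_mem_right _ x ((α.map h).symm (d * e)).2⟩ := by
    intro d e x
    conv_lhs => rw [← (α.map h).apply_symm_apply d]
    rw [← NonUnitalStarSubalgebra.coe_mul, ← _root_.map_mul]
    congr 2
    apply Subtype.ext
    simp only [NonUnitalStarSubalgebra.coe_mul, _root_.map_mul, mul_assoc]
  set L := α.map h ⟨((α.map h).symm ⟨a * b, α.mul_mem_left h a b.2⟩ : A) * c,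
        α.mul_mem_right _ c ((α.map h).symm _).2⟩ with hL
  set R := α.map h ⟨((α.map h).symm b : A) * c, α.mul_mem_right _ c ((α.map h).symm b).2⟩ with hR
  have hz : (L : A) - a * R ∈ α.D h := sub_mem L.2 (α.mul_mem_left h a R.2)
  have h0 : ∀ d : α.D h, (d : A) * ((L : A) - a * R) = 0 := by
    intro d
    have e1 := key d ⟨a * b, α.mul_mem_left h a b.2⟩ c
    have e2 := key ⟨(d : A) * a, α.mul_mem_right h a d.2⟩ b c
    rw [mul_sub, ← mul_assoc, hL, hR, e1, e2, sub_eq_zero]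
    congr 2
    apply Subtype.ext
    have : d * (⟨a * b, α.mul_mem_left h a b.2⟩ : α.D h)
        = (⟨(d : A) * a, α.mul_mem_right h a d.2⟩ : α.D h) * b :=
      Subtype.ext (by simp only [NonUnitalStarSubalgebra.coe_mul, mul_assoc])
    rw [this]
  have h1 := h0 (star ⟨_, hz⟩)
  rw [α.coe_star, CStarRing.star_mul_self_eq_zero_iff] at h1
  exact sub_eq_zero.mp h1

/-- The coefficient `α_s (α_s⁻¹(a) b) ∈ D (s * t)` of the product `(a δ_s) (b δ_t)`. -/
def coeffMul (s t : G) (a : α.D s) (b : α.D t) : α.D (s * t) :=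
  ⟨α.map s ⟨((α.map s).symm a : A) * b, α.mul_mem_right _ _ ((α.map s).symm a).2⟩, by
    have hm : ((α.map s).symm a : A) * b ∈ α.D t := α.mul_mem_left _ _ b.2
    have h1 : (α.map t ⟨(α.map t).symm ⟨_, hm⟩, ((α.map t).symm ⟨_, hm⟩).2⟩ : A)
        = ((α.map s).symm a : A) * b := by
      rw [Subtype.coe_eta, StarAlgEquiv.apply_symm_apply]
    obtain ⟨h2, h3⟩ := α.map_mul s t ((α.map t).symm ⟨_, hm⟩) ((α.map t).symm ⟨_, hm⟩).2
      (by rw [h1]; exact α.mul_mem_right _ _ ((α.map s).symm a).2)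
    rw [α.map_congr rfl h1.symm _ (by rw [h1]; exact α.mul_mem_right _ _ ((α.map s).symm a).2),
      ← h3]
    exact (α.map (s * t) _).2⟩

theorem coeffMul_add_left (s t : G) (a a' : α.D s) (b : α.D t) :
    α.coeffMul s t (a + a') b = α.coeffMul s t a b + α.coeffMul s t a' b := by
  apply Subtype.ext
  rw [NonUnitalStarSubalgebra.coe_add]
  change (α.map s _ : A) = α.map s _ + α.map s _
  rw [← NonUnitalStarSubalgebra.coe_add, ← map_add]
  congr 2
  apply Subtype.ext
  simp only [NonUnitalStarSubalgebra.coe_add, map_add, add_mul]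

theorem coeffMul_smul_left (s t : G) (c : ℂ) (a : α.D s) (b : α.D t) :
    α.coeffMul s t (c • a) b = c • α.coeffMul s t a b := by
  apply Subtype.ext
  rw [NonUnitalStarSubalgebra.coe_smul]
  change (α.map s _ : A) = c • (α.map s _ : A)
  rw [← NonUnitalStarSubalgebra.coe_smul, ← map_smul]
  congr 2
  apply Subtype.ext
  simp only [NonUnitalStarSubalgebra.coe_smul, map_smul, smul_mul_assoc]

theorem coeffMul_add_right (s t : G) (a : α.D s) (b b' : α.D t) :
    α.coeffMul s t a (b + b') = α.coeffMul s t a b + α.coeffMul s t a b' := by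
  apply Subtype.ext
  rw [NonUnitalStarSubalgebra.coe_add]
  change (α.map s _ : A) = α.map s _ + α.map s _
  rw [← NonUnitalStarSubalgebra.coe_add, ← map_add]
  congr 2
  apply Subtype.ext
  simp only [NonUnitalStarSubalgebra.coe_add, mul_add]

theorem coeffMul_smul_right (s t : G) (c : ℂ) (a : α.D s) (b : α.D t) :
    α.coeffMul s t a (c • b) = c • α.coeffMul s t a b := by
  apply Subtype.ext
  rw [NonUnitalStarSubalgebra.coe_smul]
  change (α.map s _ : A) = c • (α.map s _ : A)
  rw [← NonUnitalStarSubalgebra.coe_smul, ← map_smul]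
  congr 2
  apply Subtype.ext
  simp only [NonUnitalStarSubalgebra.coe_smul, mul_smul_comm]

/-- `α_{st}⁻¹ (α_s (α_s⁻¹(a) b)) = α_t⁻¹ (α_s⁻¹(a) b)`. -/
theorem symm_coeffMul (s t : G) (a : α.D s) (b : α.D t) :
    ((α.map (s * t)).symm (α.coeffMul s t a b) : A)
      = (α.map t).symm ⟨((α.map s).symm a : A) * b, α.mul_mem_left _ _ b.2⟩ := by
  have hm : ((α.map s).symm a : A) * b ∈ α.D t := α.mul_mem_left _ _ b.2
  have h1 : (α.map t ⟨(α.map t).symm ⟨_, hm⟩, ((α.map t).symm ⟨_, hm⟩).2⟩ : A)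
      = ((α.map s).symm a : A) * b := by
    rw [Subtype.coe_eta, StarAlgEquiv.apply_symm_apply]
  have h4 : (α.map t ⟨(α.map t).symm ⟨_, hm⟩, ((α.map t).symm ⟨_, hm⟩).2⟩ : A) ∈ α.D s⁻¹ := by
    rw [h1]; exact α.mul_mem_right _ _ ((α.map s).symm a).2
  obtain ⟨h2, h3⟩ := α.map_mul s t ((α.map t).symm ⟨_, hm⟩) ((α.map t).symm ⟨_, hm⟩).2 h4
  have h5 : α.coeffMul s t a b = α.map (s * t) ⟨(α.map t).symm ⟨_, hm⟩, h2⟩ := by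
    apply Subtype.ext
    rw [h3]
    change (α.map s ⟨_, _⟩ : A) = _
    exact α.map_congr rfl h1.symm _ _
  rw [h5, StarAlgEquiv.symm_apply_apply]

theorem coeffMul_assoc (g h k : G) (a : α.D g) (b : α.D h) (c : α.D k) :
    (α.coeffMul (g * h) k (α.coeffMul g h a b) c : A)
      = α.coeffMul g (h * k) a (α.coeffMul h k b c) := by
  have hy := α.symm_coeffMul g h a b
  set y := (α.map h).symm ⟨((α.map g).symm a : A) * b, α.mul_mem_left _ _ b.2⟩ with hydef
  have hyc : (y : A) * c ∈ α.D h⁻¹ := α.mul_mem_right _ _ y.2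
  have h1 := α.map_mul_symm h ((α.map g).symm a) b c
  have h2 : (α.map h ⟨(y : A) * c, hyc⟩ : A) ∈ α.D g⁻¹ := by
    rw [h1]; exact α.mul_mem_right _ _ ((α.map g).symm a).2
  obtain ⟨h3, h4⟩ := α.map_mul g h _ hyc h2
  change (α.map (g * h) ⟨_, _⟩ : A) = α.map g ⟨_, _⟩
  rw [α.map_congr rfl (by rw [hy]) _ h3, h4]
  exact α.map_congr rfl h1 _ _

/-- The coefficient `α_t⁻¹(a⋆) ∈ D t⁻¹` of `(a δ_t)⋆`. -/
def coeffStar (t : G) (a : α.D t) : α.D t⁻¹ := (α.map t).symm (star a)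

theorem coeffStar_coeffStar (t : G) (a : α.D t) :
    (α.coeffStar t⁻¹ (α.coeffStar t a) : A) = a := by
  unfold coeffStar
  rw [map_inv_symm, map_star, StarAlgEquiv.apply_symm_apply, star_star]

theorem coeffStar_coeffMul (s t : G) (a : α.D s) (b : α.D t) :
    (α.coeffStar (s * t) (α.coeffMul s t a b) : A)
      = α.coeffMul t⁻¹ s⁻¹ (α.coeffStar t b) (α.coeffStar s a) := by
  have hm : ((α.map s).symm a : A) * b ∈ α.D t := α.mul_mem_left _ _ b.2
  have h1 : (α.coeffStar (s * t) (α.coeffMul s t a b) : A) = (α.map t).symm (star ⟨_, hm⟩) := by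
    unfold coeffStar
    rw [map_star, map_star, α.coe_star, symm_coeffMul,
      α.coe_star]
  rw [h1, ← α.map_inv t _ (by rw [inv_inv]; exact (star (⟨_, hm⟩ : α.D t)).2)]
  refine α.map_congr rfl ?_ _ _
  unfold coeffStar
  rw [map_inv_symm, StarAlgEquiv.apply_symm_apply, map_star, α.coe_star, α.coe_star]
  exact star_mul _ _

open scoped DirectSum in
/-- The algebraic crossed product: finitely supported sections `∑ a_t δ_t` with `a_t ∈ D t`. -/
def AlgCrossedProduct : Type (max u v) := ⨁ t : G, α.D t

namespace AlgCrossedProduct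

noncomputable instance : AddCommGroup α.AlgCrossedProduct :=
  inferInstanceAs (AddCommGroup (DirectSum G fun t => α.D t))

noncomputable instance : Module ℂ α.AlgCrossedProduct :=
  inferInstanceAs (Module ℂ (DirectSum G fun t => α.D t))

open Classical in
/-- The section `a δ_t`. -/
noncomputable def single (t : G) : α.D t →ₗ[ℂ] α.AlgCrossedProduct :=
  DirectSum.lof ℂ G (fun t => α.D t) t

variable {α} in
theorem single_congr {s t : G} (h : s = t) {a : α.D s} {b : α.D t} (hab : (a : A) = b) :
    single α s a = single α t b := by
  subst h
  rw [Subtype.ext hab]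

variable {α} in
theorem induction_on {P : α.AlgCrossedProduct → Prop} (f : α.AlgCrossedProduct) (h0 : P 0)
    (h1 : ∀ t (a : α.D t), P (single α t a)) (h2 : ∀ f g, P f → P g → P (f + g)) : P f := by
  classical
  exact DirectSum.induction_on f h0 (fun t a => h1 t a) h2

/-- The linear map out of the algebraic crossed product with given values on the `a δ_t`. -/
noncomputable def lift {N : Type*} [AddCommMonoid N] [Module ℂ N] (φ : ∀ t, α.D t →ₗ[ℂ] N) :
    α.AlgCrossedProduct →ₗ[ℂ] N :=
  letI := Classical.decEq G
  DirectSum.toModule ℂ G N φ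

theorem lift_single {N : Type*} [AddCommMonoid N] [Module ℂ N] (φ : ∀ t, α.D t →ₗ[ℂ] N) (t : G)
    (a : α.D t) : lift α φ (single α t a) = φ t a := by
  classical
  exact DirectSum.toModule_lof (M := fun t => α.D t) (φ := φ) ℂ t a

/-- The bilinear map `(a, b) ↦ (a δ_s) (b δ_t) = α_s (α_s⁻¹(a) b) δ_{st}`. -/
noncomputable def mulSingle (s t : G) : α.D s →ₗ[ℂ] α.D t →ₗ[ℂ] α.AlgCrossedProduct :=
  LinearMap.mk₂ ℂ (fun (a : α.D s) (b : α.D t) => single α (s * t) (α.coeffMul s t a b))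
    (fun a a' b => by rw [coeffMul_add_left, map_add])
    (fun c a b => by rw [coeffMul_smul_left, map_smul])
    (fun a b b' => by rw [coeffMul_add_right, map_add])
    (fun c a b => by rw [coeffMul_smul_right, map_smul])

/-- The product, determined by `(a δ_s) (b δ_t) = α_s (α_s⁻¹(a) b) δ_{st}`, as a bilinear map. -/
noncomputable def mulHom :
    α.AlgCrossedProduct →ₗ[ℂ] α.AlgCrossedProduct →ₗ[ℂ] α.AlgCrossedProduct :=
  lift α fun s => (lift α fun t => (mulSingle α s t).flip).flip

theorem mulHom_single (s t : G) (a : α.D s) (b : α.D t) :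
    mulHom α (single α s a) (single α t b) = single α (s * t) (α.coeffMul s t a b) := by
  rw [mulHom, lift_single, LinearMap.flip_apply, lift_single, LinearMap.flip_apply]
  rfl

noncomputable instance : Mul α.AlgCrossedProduct := ⟨fun f g => mulHom α f g⟩

theorem single_mul_single (s t : G) (a : α.D s) (b : α.D t) :
    single α s a * single α t b = single α (s * t) (α.coeffMul s t a b) :=
  mulHom_single α s t a b

noncomputable instance : NonUnitalNonAssocRing α.AlgCrossedProduct where
  left_distrib f g h := (mulHom α f).map_add g h
  right_distrib f g h := LinearMap.map_add₂ (mulHom α) f g h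
  zero_mul f := LinearMap.map_zero₂ (mulHom α) f
  mul_zero f := (mulHom α f).map_zero

noncomputable instance : NonUnitalRing α.AlgCrossedProduct where
  mul_assoc f g h := by
    induction f using induction_on with
    | h0 => simp only [zero_mul]
    | h2 f f' hf hf' => simp only [add_mul, hf, hf']
    | h1 r a =>
    induction g using induction_on with
    | h0 => simp only [zero_mul, mul_zero]
    | h2 f f' hf hf' => simp only [add_mul, mul_add, hf, hf']
    | h1 s b =>
    induction h using induction_on with
    | h0 => simp only [mul_zero]
    | h2 f f' hf hf' => simp only [mul_add, hf, hf']
    | h1 t c =>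
    simp only [single_mul_single]
    exact single_congr (mul_assoc r s t) (α.coeffMul_assoc r s t a b c)

instance : IsScalarTower ℂ α.AlgCrossedProduct α.AlgCrossedProduct where
  smul_assoc c f g := LinearMap.map_smul₂ (mulHom α) c f g

instance : SMulCommClass ℂ α.AlgCrossedProduct α.AlgCrossedProduct where
  smul_comm c f g := ((mulHom α f).map_smul c g).symm

/-- The involution, determined by `(a δ_t)⋆ = α_t⁻¹(a⋆) δ_{t⁻¹}`, as an additive map. -/
noncomputable def starHom : α.AlgCrossedProduct →+ α.AlgCrossedProduct :=
  letI := Classical.decEq G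
  DirectSum.toAddMonoid fun t =>
    { toFun := fun a => single α t⁻¹ (α.coeffStar t a)
      map_zero' := by simp only [coeffStar, star_zero, map_zero]
      map_add' := fun a b => by simp only [coeffStar, star_add, map_add] }

theorem starHom_single (t : G) (a : α.D t) :
    starHom α (single α t a) = single α t⁻¹ (α.coeffStar t a) := by
  classical
  exact DirectSum.toAddMonoid_of (β := fun t => α.D t) _ t a

noncomputable instance : Star α.AlgCrossedProduct := ⟨fun f => starHom α f⟩

theorem star_single (t : G) (a : α.D t) :
    star (single α t a) = single α t⁻¹ (α.coeffStar t a) := starHom_single α t a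

theorem star_zero' : star (0 : α.AlgCrossedProduct) = 0 := (starHom α).map_zero

theorem star_add' (f g : α.AlgCrossedProduct) : star (f + g) = star f + star g :=
  (starHom α).map_add f g

noncomputable instance : StarRing α.AlgCrossedProduct where
  star_involutive f := by
    induction f using induction_on with
    | h0 => simp only [star_zero']
    | h2 f g hf hg => simp only [star_add', hf, hg]
    | h1 t a =>
    simp only [star_single]
    exact single_congr (inv_inv t) (α.coeffStar_coeffStar t a)
  star_mul f g := by
    induction f using induction_on with
    | h0 => simp only [star_zero', zero_mul, mul_zero]
    | h2 f f' hf hf' => simp only [star_add', add_mul, mul_add, hf, hf']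
    | h1 s a =>
    induction g using induction_on with
    | h0 => simp only [star_zero', zero_mul, mul_zero]
    | h2 f f' hf hf' => simp only [star_add', add_mul, mul_add, hf, hf']
    | h1 t b =>
    simp only [star_single, single_mul_single]
    exact single_congr (mul_inv_rev s t) (α.coeffStar_coeffMul s t a b)
  star_add := star_add' α

instance : StarModule ℂ α.AlgCrossedProduct where
  star_smul c f := by
    induction f using induction_on with
    | h0 => simp only [smul_zero, star_zero]
    | h2 f g hf hg => simp only [smul_add, star_add, hf, hg]
    | h1 t a =>
    rw [← map_smul, star_single, star_single, ← map_smul]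
    simp only [coeffStar, star_smul, map_smul]

/-- The ⋆-homomorphism `a ↦ a δ_1`. -/
noncomputable def ofAlg : A →⋆ₙₐ[ℂ] α.AlgCrossedProduct where
  toFun a := single α 1 ⟨a, by rw [α.D_one]; trivial⟩
  map_smul' c a := by
    rw [MonoidHom.id_apply, ← map_smul]; rfl
  map_zero' := (single α 1).map_zero
  map_add' a b := by rw [← map_add]; rfl
  map_mul' a b := by
    rw [single_mul_single]
    refine single_congr (mul_one 1).symm ?_
    have h : ∀ x : α.D 1, ((α.map 1).symm x : A) = x := fun x => by
      rw [← α.map_one, StarAlgEquiv.apply_symm_apply]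
    simp only [coeffMul, α.map_one, h]
  map_star' a := by
    rw [star_single]
    refine single_congr inv_one.symm ?_
    have h : ∀ x : α.D 1, ((α.map 1).symm x : A) = x := fun x => by
      rw [← α.map_one, StarAlgEquiv.apply_symm_apply]
    simp only [coeffStar, h]
    rfl

theorem seminorm_single_le (p : CStarSeminorm α.AlgCrossedProduct) (t : G) (a : α.D t) :
    p (single α t a) ≤ ‖(a : A)‖ := by
  have h1 : single α t a * star (single α t a) = ofAlg α ((a : A) * star (a : A)) := by
    rw [star_single, single_mul_single]
    refine single_congr (mul_inv_cancel t) ?_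
    have h2 : (α.map t ((α.map t).symm a * (α.map t).symm (star a)) : A) = a * star (a : A) := by
      rw [_root_.map_mul, StarAlgEquiv.apply_symm_apply, StarAlgEquiv.apply_symm_apply]
      rfl
    exact h2
  have h3 := p.star_mul_self' (star (single α t a))
  rw [star_star, h1, p.map_star] at h3
  have h4 : p (ofAlg α ((a : A) * star (a : A))) ≤ ‖(a : A) * star (a : A)‖ :=
    (p.comp (ofAlg α)).le_norm _
  rw [CStarRing.norm_self_mul_star] at h4
  exact abs_le_of_sq_le_sq' (by nlinarith) (norm_nonneg _) |>.2

/-- The C⋆-seminorms on the algebraic crossed product are pointwise bounded. -/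
theorem bddAbove_seminorms (f : α.AlgCrossedProduct) :
    BddAbove (Set.range fun p : CStarSeminorm α.AlgCrossedProduct => p f) := by
  induction f using induction_on with
  | h0 => exact ⟨0, by rintro _ ⟨p, rfl⟩; exact p.map_zero.le⟩
  | h1 t a => exact ⟨‖(a : A)‖, by rintro _ ⟨p, rfl⟩; exact seminorm_single_le α p t a⟩
  | h2 f g hf hg =>
    obtain ⟨c, hc⟩ := hf
    obtain ⟨d, hd⟩ := hg
    refine ⟨c + d, ?_⟩
    rintro _ ⟨p, rfl⟩
    exact (p.map_add_le f g).trans (add_le_add (hc ⟨p, rfl⟩) (hd ⟨p, rfl⟩))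

end AlgCrossedProduct

/-- The (full) crossed product `A ⋊_α G`: the enveloping C⋆-algebra of the algebraic crossed
product, i.e. its Hausdorff completion in the largest C⋆-seminorm. -/
def CrossedProduct : Type (max u v) :=
  (CStarSeminorm.largest (AlgCrossedProduct.bddAbove_seminorms α)).Completion

namespace CrossedProduct

noncomputable instance : NonUnitalCStarAlgebra α.CrossedProduct :=
  inferInstanceAs (NonUnitalCStarAlgebra
    (CStarSeminorm.largest (AlgCrossedProduct.bddAbove_seminorms α)).Completion)

/-- The canonical ⋆-homomorphism from the algebraic crossed product to the crossed product. -/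
noncomputable def ofAlgCrossedProduct : α.AlgCrossedProduct →⋆ₙₐ[ℂ] α.CrossedProduct :=
  (CStarSeminorm.largest (AlgCrossedProduct.bddAbove_seminorms α)).embHom

/-- The element `a δ_t` of the crossed product, for `a ∈ D t`. -/
noncomputable def δ (t : G) (a : α.D t) : α.CrossedProduct :=
  ofAlgCrossedProduct α (AlgCrossedProduct.single α t a)

end CrossedProduct

end PartialAction

/-- For subgroups `H ≤ K` of `G`, a ⋆-homomorphism `A ⋊_α H → A ⋊_α K` is induced by the
inclusion `H ≤ K` if it maps `a δ_t` to `a δ_t` for all `t ∈ H`,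
`a ∈ D t`. -/
def PartialAction.IsInducedByInclusion {G : Type u} [Group G] {A : Type v}
    [NonUnitalCStarAlgebra A] (α : PartialAction G A) {H K : Subgroup G} (h : H ≤ K)
    (φ : (α.restrict H).CrossedProduct →⋆ₙₐ[ℂ] (α.restrict K).CrossedProduct) : Prop :=
  ∀ (t : H) (a : α.D t), φ (CrossedProduct.δ (α.restrict H) t a)
    = CrossedProduct.δ (α.restrict K) (Subgroup.inclusion h t) a

/-- A ⋆-homomorphism `A ⋊_α H → A ⋊_α G` is induced by the inclusion of the subgroup `H` in `G` if
it maps `a δ_t` to `a δ_t` for all `t ∈ H`, `a ∈ D t`. -/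
def PartialAction.IsInducedBySubtype {G : Type u} [Group G] {A : Type v}
    [NonUnitalCStarAlgebra A] (α : PartialAction G A) {H : Subgroup G}
    (φ : (α.restrict H).CrossedProduct →⋆ₙₐ[ℂ] α.CrossedProduct) : Prop :=
  ∀ (t : H) (a : α.D t), φ (CrossedProduct.δ (α.restrict H) t a) = CrossedProduct.δ α t a

/-- The subgroup `𝔽_S` of the free group on `X` generated by a set `S ⊆ X` of free generators. -/
def FreeGroup.subgroupOn {X : Type u} (S : Set X) : Subgroup (FreeGroup X) :=
  Subgroup.closure (FreeGroup.of '' S)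

theorem FreeGroup.subgroupOn_mono {X : Type u} {S T : Set X} (h : S ⊆ T) :
    FreeGroup.subgroupOn S ≤ FreeGroup.subgroupOn T :=
  Subgroup.closure_mono (Set.image_mono h)

/-- The C⋆-algebra `L` with the ⋆-homomorphisms `ι i : F i → L` is an inductive (direct) limit of
the directed system of C⋆-algebras `F i` with connecting ⋆-homomorphisms `Φ : F i → F j`,
`i ≤ j`: the `ι i` are compatible with `Φ`, and every compatible family of ⋆-homomorphisms
`ψ i : F i → B` into a C⋆-algebra `B` factors through `ι` by a unique ⋆-homomorphism `L → B`. -/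
structure IsCStarInductiveLimit {I : Type*} [Preorder I] {F : I → Type*}
    [∀ i, NonUnitalCStarAlgebra (F i)] (Φ : ∀ ⦃i j : I⦄, i ≤ j → F i →⋆ₙₐ[ℂ] F j)
    {L : Type*} [NonUnitalCStarAlgebra L] (ι : ∀ i, F i →⋆ₙₐ[ℂ] L) : Prop where
  compatible : ∀ ⦃i j : I⦄ (h : i ≤ j), (ι j).comp (Φ h) = ι i
  exists_unique : ∀ (B : Type w) [NonUnitalCStarAlgebra B] (ψ : ∀ i, F i →⋆ₙₐ[ℂ] B),
    (∀ ⦃i j : I⦄ (h : i ≤ j), (ψ j).comp (Φ h) = ψ i) →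
      ∃! σ : L →⋆ₙₐ[ℂ] B, ∀ i, σ.comp (ι i) = ψ i

/-! The elements `a δ_t` span a dense subspace of a crossed product, and any family of linear maps
`D t → B` respecting the formulas for product and adjoint comes from a ⋆-homomorphism: it extends
linearly to the algebraic crossed product, and the pulled-back norm of `B` is a C⋆-seminorm, hence
dominated by the largest one. So a ⋆-homomorphism is determined by its values on the `a δ_t`
(`CrossedProduct.hom_ext`) and may be prescribed there (`CrossedProduct.exists_lift`).

The connecting maps exist because the relations among the `a δ_t` do not depend on the ambient
group. Identities between composites are checked on these elements.

For the limit, each word in a free group uses finitely many generators, so the subgroups `𝔽_λ` form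
a directed cover. A compatible family `ψ` therefore prescribes the image of each `a δ_t`
unambiguously. Each relation involves finitely many group elements and can be checked inside one
`𝔽_λ` (`exists_hom_of_directed`). No injectivity of the connecting maps is needed. -/

namespace CStarSeminorm

/-! ### Extension of contractive ⋆-homomorphisms to the completion -/

/-- The norm of a C⋆-algebra as a C⋆-seminorm. -/
noncomputable def ofNorm (B : Type w) [NonUnitalCStarAlgebra B] : CStarSeminorm B where
  toSeminorm := normSeminorm ℂ B
  mul_le' x y := norm_mul_le x y
  star_mul_self' _ := CStarRing.norm_star_mul_self

/-- A ⋆-homomorphism into a C⋆-algebra that is contractive for a C⋆-seminorm `p` extends to the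
completion with respect to `p`. -/
theorem exists_extension {S : Type u} [NonUnitalRing S] [StarRing S] [Module ℂ S]
    [IsScalarTower ℂ S S] [SMulCommClass ℂ S S] [StarModule ℂ S] (p : CStarSeminorm S)
    {B : Type w} [NonUnitalCStarAlgebra B] (f : S →⋆ₙₐ[ℂ] B) (hf : ∀ x, ‖f x‖ ≤ p x) :
    ∃ g : p.Completion →⋆ₙₐ[ℂ] B, ∀ x, g (p.emb x) = f x := by
  have hu : UniformContinuous (fun x : p.Pre => f (p.ofPre x)) := by
    refine (LipschitzWith.of_dist_le_mul (K := 1) fun x y => ?_).uniformContinuous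
    rw [dist_eq_norm, dist_eq_norm, NNReal.coe_one, one_mul, ← map_sub]
    exact hf _
  -- `extension` is defined and continuous for every function; only its agreement with `f` on the
  -- image of `S` needs the uniform continuity `hu`.
  let g : p.Completion → B := UniformSpace.Completion.extension fun x : p.Pre => f (p.ofPre x)
  have hg : Continuous g := UniformSpace.Completion.continuous_extension
  have hgf : ∀ x, g (p.emb x) = f x := fun x =>
    UniformSpace.Completion.extension_coe hu (p.toPre x)
  -- Each algebraic identity is a closed condition, so it suffices to check it on the dense image of
  -- `S`.
  refine ⟨{ toFun := g
            map_smul' := fun c => ind (isClosed_eq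
              (hg.comp (p.continuous_smul_completion c)) (hg.const_smul _)) fun x => ?_
            map_zero' := ?_
            map_add' := ind₂ (isClosed_eq (by fun_prop) (by fun_prop)) fun x y => ?_
            map_mul' := ind₂ (isClosed_eq (by fun_prop) (by fun_prop)) fun x y => ?_
            map_star' := ind (isClosed_eq (by fun_prop) (by fun_prop)) fun x => ?_ }, hgf⟩
  · rw [← emb_smul, hgf, hgf, _root_.map_smul]; rfl
  · rw [← emb_zero, hgf, _root_.map_zero]
  · rw [← emb_add, hgf, hgf, hgf, map_add]
  · rw [← emb_mul, hgf, hgf, hgf, map_mul]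
  · rw [← emb_star, hgf, hgf, StarHomClass.map_star f]

end CStarSeminorm

/-! ### The universal property of the crossed product -/

namespace PartialAction

variable {G : Type u} [Group G] {A : Type v} [NonUnitalCStarAlgebra A] (α : PartialAction G A)

/-- A covariant family of linear maps `D t → B` induces a ⋆-homomorphism on the algebraic crossed
product. -/
theorem AlgCrossedProduct.exists_lift {B : Type w} [NonUnitalCStarAlgebra B]
    (φ : ∀ t, α.D t →ₗ[ℂ] B)
    (hmul : ∀ s t a b, φ (s * t) (α.coeffMul s t a b) = φ s a * φ t b)
    (hstar : ∀ t a, φ t⁻¹ (α.coeffStar t a) = star (φ t a)) :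
    ∃ f : α.AlgCrossedProduct →⋆ₙₐ[ℂ] B, ∀ t a, f (single α t a) = φ t a := by
  refine ⟨{ toFun := lift α φ
            map_smul' := fun c x => (lift α φ).map_smul c x
            map_zero' := (lift α φ).map_zero
            map_add' := (lift α φ).map_add
            map_mul' := fun x y => ?_
            map_star' := fun x => ?_ }, lift_single α φ⟩
  · change lift α φ (x * y) = lift α φ x * lift α φ y
    -- Both sides are additive in `x` and in `y`, which reduces the claim to `a δ_s` and `b δ_t`,
    -- where it is `hmul`.
    induction x using induction_on with
    | h0 => simp only [zero_mul, map_zero]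
    | h2 x x' hx hx' => simp only [add_mul, map_add, hx, hx']
    | h1 s a =>
    induction y using induction_on with
    | h0 => simp only [mul_zero, map_zero]
    | h2 y y' hy hy' => simp only [mul_add, map_add, hy, hy']
    | h1 t b => rw [single_mul_single, lift_single, lift_single, lift_single, hmul]
  · induction x using induction_on with
    | h0 => simp only [star_zero, map_zero]
    | h2 x x' hx hx' => simp only [star_add, map_add, hx, hx']
    | h1 t a => rw [star_single, lift_single, lift_single, hstar]

namespace CrossedProduct

/-- The map `a ↦ a δ_t` as a linear map. -/
noncomputable def δₗ (t : G) : α.D t →ₗ[ℂ] α.CrossedProduct where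
  toFun := δ α t
  map_add' a b := by simp only [δ, map_add]
  map_smul' c a := by simp only [δ, map_smul, RingHom.id_apply]

theorem δ_mul_δ (s t : G) (a : α.D s) (b : α.D t) :
    δ α s a * δ α t b = δ α (s * t) (α.coeffMul s t a b) := by
  simp only [δ, ← AlgCrossedProduct.single_mul_single, _root_.map_mul]

theorem star_δ (t : G) (a : α.D t) : star (δ α t a) = δ α t⁻¹ (α.coeffStar t a) := by
  simp only [δ, ← AlgCrossedProduct.star_single, StarHomClass.map_star]

variable {α} in
/-- ⋆-homomorphisms on the crossed product that agree on the elements `a δ_t` are equal. -/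
theorem hom_ext {B : Type w} [NonUnitalCStarAlgebra B] {f g : α.CrossedProduct →⋆ₙₐ[ℂ] B}
    (h : ∀ t a, f (δ α t a) = g (δ α t a)) : f = g := by
  have key : ∀ x, f (ofAlgCrossedProduct α x) = g (ofAlgCrossedProduct α x) := fun x => by
    induction x using AlgCrossedProduct.induction_on with
    | h0 => simp only [map_zero]
    | h1 t a => exact h t a
    | h2 x y hx hy => simp only [map_add, hx, hy]
  -- Continuity is automatic: ⋆-homomorphisms between C⋆-algebras are contractive.
  have hc (k : α.CrossedProduct →⋆ₙₐ[ℂ] B) : Continuous k :=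
    AddMonoidHomClass.continuous_of_bound k 1 fun x => by
      rw [one_mul]; exact NonUnitalStarAlgHom.norm_apply_le k x
  exact NonUnitalStarAlgHom.ext fun x => CStarSeminorm.ind (isClosed_eq (hc f) (hc g)) key x

/-- The universal property of the crossed product: a covariant family of linear maps `D t → B`
into a C⋆-algebra `B` induces a ⋆-homomorphism on the crossed product. -/
theorem exists_lift {B : Type w} [NonUnitalCStarAlgebra B] (φ : ∀ t, α.D t →ₗ[ℂ] B)
    (hmul : ∀ s t a b, φ (s * t) (α.coeffMul s t a b) = φ s a * φ t b)
    (hstar : ∀ t a, φ t⁻¹ (α.coeffStar t a) = star (φ t a)) :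
    ∃ f : α.CrossedProduct →⋆ₙₐ[ℂ] B, ∀ t a, f (δ α t a) = φ t a := by
  obtain ⟨f, hf⟩ := AlgCrossedProduct.exists_lift α φ hmul hstar
  -- No bound on `f` is assumed: `x ↦ ‖f x‖` is itself one of the C⋆-seminorms whose supremum is the
  -- norm being completed.
  obtain ⟨g, hg⟩ := (CStarSeminorm.largest
      (AlgCrossedProduct.bddAbove_seminorms α)).exists_extension f fun x =>
    le_ciSup (AlgCrossedProduct.bddAbove_seminorms α x) ((CStarSeminorm.ofNorm B).comp f)
  exact ⟨g, fun t a => (hg _).trans (hf t a)⟩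

end CrossedProduct

/-! ### Homomorphisms induced by inclusions of subgroups -/

open CrossedProduct

/-- The coefficients of products and adjoints are computed from `α` alone, so they are the same over
`H` and over `K`; the relations required by the universal property are those already satisfied by
the `a δ_t` in the larger crossed product. -/
theorem exists_isInducedByInclusion {H K : Subgroup G} (h : H ≤ K) :
    ∃ φ, α.IsInducedByInclusion h φ :=
  CrossedProduct.exists_lift (α.restrict H)
    (fun t => δₗ (α.restrict K) (Subgroup.inclusion h t))
    (fun s t a b => (δ_mul_δ (α.restrict K) (Subgroup.inclusion h s) (Subgroup.inclusion h t)
      a b).symm)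
    (fun t a => (star_δ (α.restrict K) (Subgroup.inclusion h t) a).symm)

theorem exists_isInducedBySubtype (H : Subgroup G) :
    ∃ φ, α.IsInducedBySubtype (H := H) φ :=
  CrossedProduct.exists_lift (α.restrict H) (fun t => δₗ α t)
    (fun s t a b => (δ_mul_δ α s t a b).symm) (fun t a => (star_δ α t a).symm)

variable {α}

/-- Together with uniqueness below, this yields the identity `Φ_μ^ν ∘ Φ_λ^μ = Φ_λ^ν` without any
computation in the completions. -/
theorem IsInducedByInclusion.comp {H K L : Subgroup G} {h : H ≤ K} {k : K ≤ L}
    {φ : (α.restrict H).CrossedProduct →⋆ₙₐ[ℂ] (α.restrict K).CrossedProduct}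
    {φ' : (α.restrict K).CrossedProduct →⋆ₙₐ[ℂ] (α.restrict L).CrossedProduct}
    (hφ' : α.IsInducedByInclusion k φ') (hφ : α.IsInducedByInclusion h φ) :
    α.IsInducedByInclusion (h.trans k) (φ'.comp φ) := fun t a =>
  (congrArg φ' (hφ t a)).trans (hφ' (Subgroup.inclusion h t) a)

theorem IsInducedBySubtype.comp {H K : Subgroup G} {h : H ≤ K}
    {φ : (α.restrict H).CrossedProduct →⋆ₙₐ[ℂ] (α.restrict K).CrossedProduct}
    {φ' : (α.restrict K).CrossedProduct →⋆ₙₐ[ℂ] α.CrossedProduct}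
    (hφ' : α.IsInducedBySubtype φ') (hφ : α.IsInducedByInclusion h φ) :
    α.IsInducedBySubtype (φ'.comp φ) := fun t a =>
  (congrArg φ' (hφ t a)).trans (hφ' (Subgroup.inclusion h t) a)

theorem IsInducedByInclusion.unique {H K : Subgroup G} {h : H ≤ K}
    {φ φ' : (α.restrict H).CrossedProduct →⋆ₙₐ[ℂ] (α.restrict K).CrossedProduct}
    (hφ : α.IsInducedByInclusion h φ) (hφ' : α.IsInducedByInclusion h φ') : φ = φ' :=
  hom_ext fun t a => (hφ t a).trans (hφ' t a).symm

theorem IsInducedBySubtype.unique {H : Subgroup G}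
    {φ φ' : (α.restrict H).CrossedProduct →⋆ₙₐ[ℂ] α.CrossedProduct}
    (hφ : α.IsInducedBySubtype φ) (hφ' : α.IsInducedBySubtype φ') : φ = φ' :=
  hom_ext fun t a => (hφ t a).trans (hφ' t a).symm

/-! ### Gluing along a directed cover by subgroups -/

variable (α)

/-- A compatible family of ⋆-homomorphisms on the crossed products by a directed family of
subgroups that covers `G` factors through the crossed product by `G`. -/
theorem exists_hom_of_directed {I : Type*} [Preorder I] [IsDirectedOrder I] (H : I → Subgroup G)
    (hH : ∀ ⦃i j⦄, i ≤ j → H i ≤ H j) (hcover : ∀ t, ∃ i, t ∈ H i)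
    {B : Type w} [NonUnitalCStarAlgebra B]
    (ψ : ∀ i, (α.restrict (H i)).CrossedProduct →⋆ₙₐ[ℂ] B)
    (hψ : ∀ ⦃i j⦄ (h : i ≤ j) (t : H i) (a : α.D t),
      ψ j (δ (α.restrict (H j)) (Subgroup.inclusion (hH h) t) a)
        = ψ i (δ (α.restrict (H i)) t a)) :
    ∃ σ : α.CrossedProduct →⋆ₙₐ[ℂ] B, ∀ i (t : H i) (a : α.D t),
      σ (δ α t a) = ψ i (δ (α.restrict (H i)) t a) := by
  -- `c t` is an arbitrary index with `t ∈ H (c t)`; nothing relates `c (s * t)` or `c t⁻¹` to `c s`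
  -- and `c t`.
  choose c hc using hcover
  -- The prescribed value does not depend on the index: two choices are compared at a common upper
  -- bound.
  have indep : ∀ i j t (hi : t ∈ H i) (hj : t ∈ H j) (a : α.D t),
      ψ i (δ (α.restrict (H i)) ⟨t, hi⟩ a) = ψ j (δ (α.restrict (H j)) ⟨t, hj⟩ a) := by
    intro i j t hi hj a
    obtain ⟨k, hik, hjk⟩ := exists_ge_ge i j
    exact (hψ hik ⟨t, hi⟩ a).symm.trans (hψ hjk ⟨t, hj⟩ a)
  obtain ⟨σ, hσ⟩ := CrossedProduct.exists_lift α
    (fun t => (ψ (c t) : _ →ₗ[ℂ] B) ∘ₗ δₗ (α.restrict (H (c t))) ⟨t, hc t⟩)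
    (fun s t a b => by
      -- `H k` contains `s` and `t`, hence `s * t`. By `indep` all three values may be computed with
      -- `ψ k`, which is multiplicative.
      obtain ⟨k, hsk, htk⟩ := exists_ge_ge (c s) (c t)
      have hs := hH hsk (hc s)
      have ht := hH htk (hc t)
      change ψ _ (δ (α.restrict (H _)) ⟨s * t, _⟩ _)
        = ψ _ (δ (α.restrict (H _)) ⟨s, _⟩ _) * ψ _ (δ (α.restrict (H _)) ⟨t, _⟩ _)
      rw [indep _ k _ _ (mul_mem hs ht), indep _ k _ _ hs, indep _ k _ _ ht, ← _root_.map_mul]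
      exact congrArg (ψ k) (δ_mul_δ (α.restrict (H k)) ⟨s, hs⟩ ⟨t, ht⟩ a b).symm)
    (fun t a => by
      change ψ _ (δ (α.restrict (H _)) ⟨t⁻¹, _⟩ _) = star (ψ _ (δ (α.restrict (H _)) ⟨t, _⟩ _))
      -- No upper bound is needed here, since `H (c t)` already contains `t⁻¹`.
      rw [indep _ (c t) _ _ (inv_mem (hc t)), ← StarHomClass.map_star]
      exact congrArg (ψ (c t)) (star_δ (α.restrict (H (c t))) ⟨t, hc t⟩ a).symm)
  exact ⟨σ, fun i t a => (hσ t a).trans (indep _ i t _ t.2 a)⟩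

end PartialAction

/-! ### The free group and its finitely generated pieces -/

/-- Every element of a free group lies in the subgroup generated by finitely many generators. -/
theorem FreeGroup.exists_mem_subgroupOn {X : Type u} (t : FreeGroup X) :
    ∃ l : Finset X, t ∈ FreeGroup.subgroupOn (l : Set X) := by
  classical
  induction t using FreeGroup.induction_on with
  | C1 => exact ⟨∅, one_mem _⟩
  | of x => exact ⟨{x}, Subgroup.subset_closure ⟨x, by simp, rfl⟩⟩
  | inv_of x hx =>
    obtain ⟨l, hl⟩ := hx
    exact ⟨l, inv_mem hl⟩
  | mul s t hs ht =>
    obtain ⟨l, hl⟩ := hs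
    obtain ⟨m, hm⟩ := ht
    exact ⟨l ∪ m, mul_mem
      (FreeGroup.subgroupOn_mono (Finset.coe_subset.mpr Finset.subset_union_left) hl)
      (FreeGroup.subgroupOn_mono (Finset.coe_subset.mpr Finset.subset_union_right) hm)⟩

/-- Each equivalence encodes existence and uniqueness together: right to left, applied to `Φ h` or
`ι l` itself, gives existence; left to right gives uniqueness. -/
theorem mainTheorem5 {𝒢 : Type u} {A : Type v} [NonUnitalCStarAlgebra A]
    (α : PartialAction (FreeGroup 𝒢) A) :
    ∃ (Φ : ∀ ⦃l m : Finset 𝒢⦄, l ≤ m →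
          ((α.restrict (FreeGroup.subgroupOn (l : Set 𝒢))).CrossedProduct →⋆ₙₐ[ℂ]
            (α.restrict (FreeGroup.subgroupOn (m : Set 𝒢))).CrossedProduct))
      (ι : ∀ l : Finset 𝒢,
          (α.restrict (FreeGroup.subgroupOn (l : Set 𝒢))).CrossedProduct →⋆ₙₐ[ℂ]
            α.CrossedProduct),
      (∀ ⦃l m : Finset 𝒢⦄ (h : l ≤ m) φ,
        α.IsInducedByInclusion (FreeGroup.subgroupOn_mono (Finset.coe_subset.mpr h)) φ ↔
          φ = Φ h) ∧
      (∀ (l : Finset 𝒢) φ, α.IsInducedBySubtype φ ↔ φ = ι l) ∧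
      DirectedSystem
        (fun l : Finset 𝒢 => (α.restrict (FreeGroup.subgroupOn (l : Set 𝒢))).CrossedProduct)
        (fun _ _ h => Φ h) ∧
      IsCStarInductiveLimit.{w} Φ ι := by
  choose Φ hΦ using fun (l m : Finset 𝒢) (h : l ≤ m) => α.exists_isInducedByInclusion
    (FreeGroup.subgroupOn_mono (Finset.coe_subset.mpr h))
  choose ι hι using fun l : Finset 𝒢 =>
    α.exists_isInducedBySubtype (FreeGroup.subgroupOn (l : Set 𝒢))
  refine ⟨fun l m h => Φ l m h, ι, fun l m h φ => ⟨fun hφ => ?_, ?_⟩,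
    fun l φ => ⟨fun hφ => ?_, ?_⟩, ⟨fun l x => ?_, fun n m l hlm hmn x => ?_⟩,
    ⟨fun l m h => ?_, fun B _ ψ hψ => ?_⟩⟩
  · exact hφ.unique (hΦ l m h)
  · rintro rfl
    exact hΦ l m h
  · exact hφ.unique (hι l)
  · rintro rfl
    exact hι l
  -- The identity also fixes every `a δ_t`, so uniqueness identifies it with `Φ l l`.
  · have h : Φ l l le_rfl = NonUnitalStarAlgHom.id ℂ _ :=
      (hΦ l l le_rfl).unique fun _ _ => rfl
    exact DFunLike.congr_fun h x
  · exact DFunLike.congr_fun (((hΦ m n hmn).comp (hΦ l m hlm)).unique (hΦ l n (hlm.trans hmn))) x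
  · exact ((hι m).comp (hΦ l m h)).unique (hι l)
  · obtain ⟨σ, hσ⟩ := α.exists_hom_of_directed
      (fun l : Finset 𝒢 => FreeGroup.subgroupOn (l : Set 𝒢))
      (fun _ _ h => FreeGroup.subgroupOn_mono (Finset.coe_subset.mpr h))
      FreeGroup.exists_mem_subgroupOn ψ
      -- Since `Φ` sends `a δ_t` to `a δ_t`, compatibility of `ψ` with `Φ` becomes the condition on
      -- these elements required for gluing.
      (fun l m h t a => (congrArg (ψ m) (hΦ l m h t a)).symm.trans
        (DFunLike.congr_fun (hψ h) _))
    refine ⟨σ, fun l => PartialAction.CrossedProduct.hom_ext fun t a =>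
      (congrArg σ (hι l t a)).trans (hσ l t a), fun τ hτ => ?_⟩
    -- Uniqueness: every `a δ_t` lies in the range of some `ι l`, where the value of `τ` is forced
    -- by `ψ l`.
    refine PartialAction.CrossedProduct.hom_ext fun t a => ?_
    obtain ⟨l, hl⟩ := FreeGroup.exists_mem_subgroupOn t
    exact ((congrArg τ (hι l ⟨t, hl⟩ a)).symm.trans (DFunLike.congr_fun (hτ l) _)).trans
      (hσ l ⟨t, hl⟩ a).symm
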